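/- **Setting.** Let $g(x,y)=x_0y_0-x_1y_1-\dots-x_4y_4$ on $\mathbb R^5$ and $dS=\{x\in\mathbb R^5 : g(x,x)=-1\}$. Write points of $dS$ as $(\tau,\omega)$, $\tau\in(-\frac{\pi}{2},\frac{\pi}{2})$, $\omega\in S^3$, meaning $(\tan\tau,\omega/\cos\tau)$. Fix $0<\alpha\le\pi/2$. The Robertson–Walker space-times considered are those with metric $S^2(\tau)(d\tau^2-d\sigma^2)$ on $(-\alpha,\alpha)\times S^3$, where $d\sigma^2$ is the metric of the unit sphere and $S>0$ is smooth; such a space-time is identified with its conformal embedding $RW=\{x\in dS : |\tau(x)|<\alpha\}$. A *worldline* is a $C^2$ timelike curve $t\mapsto x_t\in RW$, $t\in\mathbb R$ (not necessarily parametrized by proper time). Let $s$ be its de Sitter proper time, $a_t=d^2x_t/ds^2\in\mathbb R^5$, and $M_t=g(\dot x_t,\cdot)\,a_t-g(a_t,\cdot)\,\dot x_t$. The curve $\Lambda_t=T\exp\int_0^tM_s\,ds$ in $SO_0(4,1)$, i.e. the solution of $\dot\Lambda_t=M_t\Lambda_t$, $\Lambda_0=1$, is the curve attached to the worldline. *Wedges*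 of $dS$ are the sets $W=\lambda\{x_1>|x_0|\}\cap dS$, $\lambda\in SO_0(4,1)$; the edge of $W$ is $E=\lambda\{x_0=x_1=0\}\cap dS$. A *covariant de Sitter theory* consists of von Neumann algebras $\mathcal R(W)$ on a complex Hilbert space $\mathcal H$, a strongly continuous unitary representation $U$ of $SO_0(4,1)$ with $U(\lambda)\mathcal R(W)U(\lambda)^{-1}=\mathcal R(\lambda W)$, and a unit vector $\Omega$ with $U(\lambda)\Omega=\Omega$. It has the *Reeh–Schlieder property* if $\Omega$ is cyclic for $\mathcal R(\mathcal O)=\bigcap_{W\supset\mathcal O}\mathcal R(W)$ for every nonempty bounded open $\mathcal O\subset dS$. (An empty intersection of algebras is read as $\mathcal B(\mathcal H)$.) Let $\Phi(\tau,\omega)=(\arcsin(\sin\alpha\sin\tau),\omega)$. For a wedge $W$ with edge $E$, let $\Xi(W)$ be the connected component of the causal complement of $\Phi(E)$ in $RW$ which meets $W$. The *transplanted net* on $RW$ is $\mathcal R^{RW}(\Xi(W))=\mathcal R(W)$ and $\mathcal R^{RW}(\mathcal O)=\bigcap_{\Xi(W)\supset\mathcal O}\mathcal R(W)$ for $\mathcal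 O\subset RW$; let $\mathcal R^{RW}$ be the von Neumann algebra generated by all $\mathcal R(W)$. Put $\alpha_{t,s}=\mathrm{Ad}\,U(\Lambda_t\Lambda_s^{-1})$ for $s,t\in\mathbb R$. A *double cone* in $RW$ is a nonempty set $I_+(p)\cap I_-(q)$ with $p,q\in RW$, where $I_\pm$ denotes the interior of the future/past light cone in $RW$. A family of double cones is *continuous* if its past and future apices can be chosen continuous in the parameter. The closed upright double cone of size $\varepsilon\ge0$ around $x=(\tau,\omega)$, with $|\tau\pm\varepsilon|<\alpha$, is the intersection in $RW$ of the closed future cone of $(\tau-\varepsilon,\omega)$ and the closed past cone of $(\tau+\varepsilon,\omega)$; it is $\{x\}$ for $\varepsilon=0$. A set $\mathcal O\subset RW$ is *sufficiently large for* $x$ if $|\tau(x)\pm(\frac{\pi}{2}-\alpha)|<\alpha$ and $\mathcal O$ contains the closed upright double cone of size $\frac{\pi}{2}-\alpha$ around $x$. **Theorem.** Let the de Sitter theory be covariant with the Reeh–Schlieder property, let $t\mapsto x_t$ be a worldline in $RW$ with attached curve $\Lambda_t$, let $I\subset\mathbb R$ be compact, and let $\{\mathcal O_t\}_{t\in I}$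 be a continuous family of double cones in $RW$ such that $\mathcal O_t$ is sufficiently large for $x_t$ for every $t\in I$. Then $\{\alpha_{t,s}\}$ is a quasi-covariant dynamics for this family. That is: 1. The maps $\alpha_{t,s}$, $s,t\in\mathbb R$, restrict to automorphisms of $\mathcal R^{RW}$ with $\alpha_{t,s}\alpha_{s,t'}=\alpha_{t,t'}$ and $\alpha_{t,t}=\mathrm{id}$, and for each $A\in\mathcal R^{RW}$ the operator $\alpha_{t,s}(A)$ is continuous in $t$ for fixed $s$, and in $s$ for fixed $t$, in the weak operator topology. 2. With $\mathcal R_0(\mathcal O_t)=\bigcap_{s\in I}\alpha_{t,s}\,\mathcal R^{RW}(\mathcal O_s)$ one has, for all $t,s\in I$: $\mathcal R_0(\mathcal O_t)\subset\mathcal R^{RW}(\mathcal O_t)$, $\alpha_{t,s}\mathcal R_0(\mathcal O_s)=\mathcal R_0(\mathcal O_t)$, and $\Omega$ is cyclic for $\mathcal R_0(\mathcal O_t)$. -/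

import Mathlib

open scoped InnerProductSpace

noncomputable section

namespace RWDyn

/-! ### Five-dimensional Minkowski space and the de Sitter group -/

/-- The ambient space `ℝ⁵`; index `0` is the time coordinate. -/
abbrev Mink : Type := Fin 5 → ℝ

/-- The Minkowski form `x₀y₀ - x₁y₁ - x₂y₂ - x₃y₃ - x₄y₄`. -/
def g (x y : Mink) : ℝ := x 0 * y 0 - ∑ i : Fin 4, x i.succ * y i.succ

/-- The unit vector in the time direction. -/
def e0 : Mink := Pi.single 0 1

theorem g_e0_left (x : Mink) : g e0 x = x 0 := by
  simp [g, e0]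

theorem g_comm (x y : Mink) : g x y = g y x := by
  simp [g, mul_comm]

/-- Future directed unit timelike vectors have a positive product. -/
theorem g_pos_of_future {u w : Mink} (hu : g u u = 1) (hw : g w w = 1)
    (hu0 : 0 < u 0) (hw0 : 0 < w 0) : 0 < g u w := by
  have cs := Finset.sum_mul_sq_le_sq_mul_sq (Finset.univ : Finset (Fin 4))
    (fun i => u i.succ) (fun i => w i.succ)
  have hu' : ∑ i : Fin 4, u i.succ ^ 2 = u 0 ^ 2 - 1 := by
    simp only [g, ← pow_two] at hu; linarith
  have hw' : ∑ i : Fin 4, w i.succ ^ 2 = w 0 ^ 2 - 1 := by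
    simp only [g, ← pow_two] at hw; linarith
  rw [hu', hw'] at cs
  have h1 : 0 ≤ w 0 ^ 2 - 1 := by
    rw [← hw']; exact Finset.sum_nonneg fun i _ => sq_nonneg _
  have h2 : 0 ≤ u 0 ^ 2 - 1 := by
    rw [← hu']; exact Finset.sum_nonneg fun i _ => sq_nonneg _
  have hlt : (∑ i : Fin 4, u i.succ * w i.succ) ^ 2 < (u 0 * w 0) ^ 2 := by
    nlinarith
  have := abs_lt_of_sq_lt_sq hlt (by positivity)
  have := (abs_lt.mp this).2
  unfold g
  linarith

/-- The proper orthochronous Lorentz group `SO₀(4,1)`: the real invertible `5 × 5` matrices which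
preserve the Minkowski form, have determinant one, and preserve the direction of time. -/
def SO0 : Subgroup (GL (Fin 5) ℝ) where
  carrier := {A | (∀ x y : Mink, g (A.val.mulVec x) (A.val.mulVec y) = g x y) ∧
    A.val.det = 1 ∧ 0 < A.val 0 0}
  one_mem' := by simp
  inv_mem' := by
    rintro A ⟨h1, h2, h3⟩
    have hinv : ∀ x : Mink, A.val.mulVec ((A⁻¹).val.mulVec x) = x := by
      intro x
      rw [Matrix.mulVec_mulVec, ← Units.val_mul, mul_inv_cancel, Units.val_one, Matrix.one_mulVec]
    refine ⟨fun x y => ?_, ?_, ?_⟩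
    · rw [← h1, hinv, hinv]
    · have h := congrArg Matrix.det (show A.val * (A⁻¹).val = 1 by
        rw [← Units.val_mul, mul_inv_cancel, Units.val_one])
      rw [Matrix.det_mul, h2, one_mul, Matrix.det_one] at h
      exact h
    · have h : (A⁻¹).val 0 0 = A.val 0 0 := by
        have e := h1 e0 ((A⁻¹).val.mulVec e0)
        rw [hinv, g_e0_left, g_comm, g_e0_left] at e
        simpa [e0] using e.symm
      rw [h]; exact h3
  mul_mem' := by
    rintro A B ⟨a1, a2, a3⟩ ⟨b1, b2, b3⟩
    have hinv : ∀ x : Mink, A.val.mulVec ((A⁻¹).val.mulVec x) = x := by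
      intro x
      rw [Matrix.mulVec_mulVec, ← Units.val_mul, mul_inv_cancel, Units.val_one, Matrix.one_mulVec]
    have ge : g e0 e0 = 1 := by rw [g_e0_left]; simp [e0]
    refine ⟨fun x y => ?_, ?_, ?_⟩
    · rw [Units.val_mul, ← Matrix.mulVec_mulVec, ← Matrix.mulVec_mulVec, a1, b1]
    · rw [Units.val_mul, Matrix.det_mul, a2, b2, one_mul]
    · have h00 : ((A⁻¹).val.mulVec e0) 0 = A.val 0 0 := by
        have e := a1 e0 ((A⁻¹).val.mulVec e0)
        rw [hinv, g_e0_left, g_comm, g_e0_left] at e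
        rw [← e]; simp [e0]
      have key : 0 < g ((A⁻¹).val.mulVec e0) (B.val.mulVec e0) := by
        apply g_pos_of_future
        · rw [← a1, hinv, ge]
        · rw [b1, ge]
        · rw [h00]; exact a3
        · simpa [e0] using b3
      rw [← a1, hinv, Matrix.mulVec_mulVec, ← Units.val_mul, g_e0_left] at key
      simpa [e0] using key

/-- The linear action of the de Sitter group on `ℝ⁵`. -/
def act (L : SO0) (x : Mink) : Mink := (L : GL (Fin 5) ℝ).val.mulVec x

/-! ### De Sitter and Robertson–Walker space-time -/

/-- De Sitter space-time as a hyperboloid in Minkowski space. -/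
def dS : Set Mink := {x | g x x = -1}

/-- The conformal time `τ`, with values in `(-π/2, π/2)`. The point of `dS` with coordinates
`τ` and `ω ∈ S³` is `(tan τ, ω / cos τ)`. -/
def tau (x : Mink) : ℝ := Real.arctan (x 0)

/-- For `x ∈ dS`, the point with conformal time `s` and the same `S³` coordinates as `x`
(for `s ∈ (-π/2, π/2)`). -/
def setTau (x : Mink) (s : ℝ) : Mink :=
  Fin.cons (Real.tan s) fun i : Fin 4 => Real.cos (tau x) / Real.cos s * x i.succ

/-- Robertson–Walker space-time with embedding parameter `α`, identified with its conformal
embedding into `dS`. Its metric is a positive multiple of the restriction of the de Sitter metric,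
so both have the same timelike curves, light cones and causal complements. -/
def RW (α : ℝ) : Set Mink := {x | x ∈ dS ∧ |tau x| < α}

/-- The interior of the future light cone of `p` in `RW`. -/
def Iplus (α : ℝ) (p : Mink) : Set Mink := {y | y ∈ RW α ∧ 0 < g (y - p) (y - p) ∧ p 0 < y 0}

/-- The interior of the past light cone of `p` in `RW`. -/
def Iminus (α : ℝ) (p : Mink) : Set Mink := {y | y ∈ RW α ∧ 0 < g (y - p) (y - p) ∧ y 0 < p 0}

/-- The closed future light cone (with its interior) of `p` in `RW`. -/
def Jplus (α : ℝ) (p : Mink) : Set Mink := {y | y ∈ RW α ∧ 0 ≤ g (y - p) (y - p) ∧ p 0 ≤ y 0}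

/-- The closed past light cone (with its interior) of `p` in `RW`. -/
def Jminus (α : ℝ) (p : Mink) : Set Mink := {y | y ∈ RW α ∧ 0 ≤ g (y - p) (y - p) ∧ y 0 ≤ p 0}

/-- The double cone with past apex `p` and future apex `q`. -/
def doubleCone (α : ℝ) (p q : Mink) : Set Mink := Iplus α p ∩ Iminus α q

/-- The closed upright double cone of size `ε` around `x` (to be used for `|τ(x) ± ε| < α`).
For `ε > 0` it is the closure of the upright double cone, for `ε = 0` it is `{x}`. -/
def closedUpright (α : ℝ) (x : Mink) (ε : ℝ) : Set Mink :=
  Jplus α (setTau x (tau x - ε)) ∩ Jminus α (setTau x (tau x + ε))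

/-- The region `O` is sufficiently large for `x`: the closed upright double cone of size `π/2 - α`
around `x` exists in `RW` and is contained in `O`. -/
def SufficientlyLarge (α : ℝ) (x : Mink) (O : Set Mink) : Prop :=
  |tau x - (Real.pi / 2 - α)| < α ∧ |tau x + (Real.pi / 2 - α)| < α ∧
    closedUpright α x (Real.pi / 2 - α) ⊆ O

/-- A family of double cones in `RW` indexed by `t ∈ I` whose past and future apices depend
continuously on `t`. -/
def IsContinuousDoubleConeFamily (α : ℝ) (I : Set ℝ) (O : ℝ → Set Mink) : Prop :=
  ∃ p q : ℝ → Mink, ContinuousOn p I ∧ ContinuousOn q I ∧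
    ∀ t ∈ I, p t ∈ RW α ∧ q t ∈ RW α ∧ O t = doubleCone α (p t) (q t) ∧ (O t).Nonempty

/-! ### Wedges, edges and the correspondence `Ξ` -/

/-- The standard wedge `x₁ > |x₀|` in Minkowski space. -/
def stdWedge : Set Mink := {x | |x 0| < x 1}

/-- The edge `x₀ = x₁ = 0` of the standard wedge. -/
def stdEdge : Set Mink := {x | x 0 = 0 ∧ x 1 = 0}

/-- The set of de Sitter wedges. -/
def dSWedges : Set (Set Mink) := {W | ∃ L : SO0, W = act L '' stdWedge ∩ dS}

/-- The de Sitter edge of a de Sitter wedge: `L E ∩ dS` for `W = L W₁ ∩ dS`, where `W₁` is the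
standard wedge with edge `E`. (It does not depend on the choice of `L`.) -/
def edge (W : Set Mink) : Set Mink :=
  {x | ∃ L : SO0, W = act L '' stdWedge ∩ dS ∧ x ∈ act L '' stdEdge ∩ dS}

/-- The causal complement in `RW`: all points of `RW` spacelike to every point of `S`. -/
def causalComplement (α : ℝ) (S : Set Mink) : Set Mink :=
  {y | y ∈ RW α ∧ ∀ x ∈ S, g (y - x) (y - x) < 0}

/-- The diffeomorphism `Φ` of `dS` onto `RW`, which maps `τ` to `arcsin (sin α sin τ)` and keeps
the `S³` coordinates. -/
def Phi (α : ℝ) (x : Mink) : Mink :=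
  setTau x (Real.arcsin (Real.sin α * Real.sin (tau x)))

/-- `Ξ(W)`: the connected component of the causal complement `Φ(E)'` in `RW` which meets `W`,
where `E` is the edge of `W`. -/
def Xi (α : ℝ) (W : Set Mink) : Set Mink :=
  {y | y ∈ causalComplement α (Phi α '' edge W) ∧
    (connectedComponentIn (causalComplement α (Phi α '' edge W)) y ∩ W).Nonempty}

/-! ### The curve in the de Sitter group attached to a worldline -/

/-- A worldline in `RW`: a `C²` curve with everywhere timelike tangent vector. The parameter need
not be proper time. -/
structure IsWorldline (α : ℝ) (x : ℝ → Mink) : Prop where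
  contDiff : ContDiff ℝ 2 x
  mem : ∀ t, x t ∈ RW α
  timelike : ∀ t, 0 < g (deriv x t) (deriv x t)

/-- The derivative `dx/ds` with respect to the de Sitter proper time `s`. -/
def unitTangent (x : ℝ → Mink) (t : ℝ) : Mink :=
  (Real.sqrt (g (deriv x t) (deriv x t)))⁻¹ • deriv x t

/-- The acceleration `d²x/ds²` in the ambient Minkowski space, `s` being de Sitter proper time. -/
def acceleration (x : ℝ → Mink) (t : ℝ) : Mink :=
  (Real.sqrt (g (deriv x t) (deriv x t)))⁻¹ • deriv (unitTangent x) t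

/-- The infinitesimal transformation `M_t = g(ẋ_t, ·) a_t - g(a_t, ·) ẋ_t`. -/
def generator (x : ℝ → Mink) (t : ℝ) (y : Mink) : Mink :=
  g (deriv x t) y • acceleration x t - g (acceleration x t) y • deriv x t

/-- The curve `Λ` in the de Sitter group is the time-ordered exponential `T exp ∫₀ᵗ M_s ds`, i.e.
the solution of `dΛ/dt = M_t Λ_t` with `Λ_0 = 1`. -/
structure IsObserverCurve (x : ℝ → Mink) (L : ℝ → SO0) : Prop where
  initial : L 0 = 1
  hasDerivAt : ∀ (t : ℝ) (y : Mink),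
    HasDerivAt (fun r => act (L r) y) (generator x t (act (L t) y)) t

/-! ### Nets of von Neumann algebras and dynamics -/

section Quantum

variable {H : Type*} [NormedAddCommGroup H] [InnerProductSpace ℂ H] [CompleteSpace H]

/-- The vector `Ω` is cyclic for the algebra `M`. -/
def IsCyclic (Ω : H) (M : StarSubalgebra ℂ (H →L[ℂ] H)) : Prop :=
  Dense {ψ : H | ∃ A ∈ M, A Ω = ψ}

/-- The automorphism `Ad u : A ↦ u A u*` of `B(H)`. -/
def Ad (u : unitary (H →L[ℂ] H)) : (H →L[ℂ] H) ≃⋆ₐ[ℂ] (H →L[ℂ] H) :=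
  Unitary.conjStarAlgAut ℂ (H →L[ℂ] H) u

variable (H) in
/-- A covariant de Sitter theory on the Hilbert space `H`: a net of von Neumann algebras indexed by
wedges, a strongly continuous unitary representation of `SO₀(4,1)` acting covariantly, and an
invariant state vector. Only the values of `alg` on de Sitter wedges matter. -/
structure DeSitterTheory where
  /-- The algebra of a wedge. -/
  alg : Set Mink → VonNeumannAlgebra H
  /-- The unitary representation. -/
  U : SO0 →* unitary (H →L[ℂ] H)
  /-- The state vector. -/
  Ω : H
  norm_Ω : ‖Ω‖ = 1
  continuous_U : ∀ ψ : H, Continuous fun L : SO0 => (U L : H →L[ℂ] H) ψ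
  covariant : ∀ (L : SO0), ∀ W ∈ dSWedges,
    (alg W).toStarSubalgebra.map (Ad (U L)).toStarAlgHom = (alg (act L '' W)).toStarSubalgebra
  invariant : ∀ L : SO0, (U L : H →L[ℂ] H) Ω = Ω

/-- The de Sitter algebra of a region `O`: the intersection of the algebras of all wedges
containing `O`. -/
def DeSitterTheory.dSAlg (T : DeSitterTheory H) (O : Set Mink) : StarSubalgebra ℂ (H →L[ℂ] H) :=
  ⨅ W ∈ {W | W ∈ dSWedges ∧ O ⊆ W}, (T.alg W).toStarSubalgebra

/-- The Reeh–Schlieder property: `Ω` is cyclic for the algebra of every nonempty bounded open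
region of `dS`. (If no wedge contains the region, this holds trivially.) -/
def DeSitterTheory.ReehSchlieder (T : DeSitterTheory H) : Prop :=
  ∀ V : Set Mink, IsOpen V → Bornology.IsBounded (V ∩ dS) → (V ∩ dS).Nonempty →
    IsCyclic T.Ω (T.dSAlg (V ∩ dS))

/-- The transplanted Robertson–Walker algebra of a region `O ⊆ RW`: the intersection of the algebras
`R(Ξ(W)) = R(W)` of all Robertson–Walker wedges `Ξ(W)` containing `O`. -/
def DeSitterTheory.rwAlg (T : DeSitterTheory H) (α : ℝ) (O : Set Mink) :
    StarSubalgebra ℂ (H →L[ℂ] H) :=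
  ⨅ W ∈ {W | W ∈ dSWedges ∧ O ⊆ Xi α W}, (T.alg W).toStarSubalgebra

/-- The global observable algebra: the von Neumann algebra (bicommutant) generated by the algebras
of all wedges. -/
def DeSitterTheory.globalAlg (T : DeSitterTheory H) : StarSubalgebra ℂ (H →L[ℂ] H) :=
  StarSubalgebra.centralizer ℂ (StarSubalgebra.centralizer ℂ
    (⋃ W ∈ dSWedges, ((T.alg W : VonNeumannAlgebra H) : Set (H →L[ℂ] H))) : Set (H →L[ℂ] H))

/-- The propagators `α_{t,s} = Ad U(Λ_t Λ_s⁻¹)`. -/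
def DeSitterTheory.propagator (T : DeSitterTheory H) (L : ℝ → SO0) (t s : ℝ) :
    (H →L[ℂ] H) ≃⋆ₐ[ℂ] (H →L[ℂ] H) :=
  Ad (T.U (L t * (L s)⁻¹))

/-- A propagator family on the observable algebra `M`: each `P t s` restricts to an automorphism of
`M`, the propagator identities hold, and `P t s A` is continuous in `t` and in `s` for the weak
operator topology. -/
structure IsPropagatorFamily (M : StarSubalgebra ℂ (H →L[ℂ] H))
    (P : ℝ → ℝ → (H →L[ℂ] H) ≃⋆ₐ[ℂ] (H →L[ℂ] H)) : Prop where
  map_eq : ∀ t s, M.map (P t s).toStarAlgHom = M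
  comp : ∀ t s t', ∀ A ∈ M, P t s (P s t' A) = P t t' A
  refl : ∀ t, ∀ A ∈ M, P t t A = A
  continuous_left : ∀ s, ∀ A ∈ M, ∀ φ ψ : H, Continuous fun t => ⟪φ, P t s A ψ⟫_ℂ
  continuous_right : ∀ t, ∀ A ∈ M, ∀ φ ψ : H, Continuous fun s => ⟪φ, P t s A ψ⟫_ℂ

/-- The propagator family `P` is a quasi-covariant dynamics for the regions with local algebras
`R t`, `t ∈ I`, the subalgebras `R₀ t ⊆ R t` being mapped onto each other by the propagators and
having `Ω` as a cyclic vector. -/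
structure IsQuasiCovariantDynamics (M : StarSubalgebra ℂ (H →L[ℂ] H)) (Ω : H)
    (P : ℝ → ℝ → (H →L[ℂ] H) ≃⋆ₐ[ℂ] (H →L[ℂ] H)) (I : Set ℝ)
    (R R₀ : ℝ → StarSubalgebra ℂ (H →L[ℂ] H)) : Prop where
  propagatorFamily : IsPropagatorFamily M P
  sub_le : ∀ t ∈ I, R₀ t ≤ R t
  map_eq : ∀ t ∈ I, ∀ s ∈ I, (R₀ s).map (P t s).toStarAlgHom = R₀ t
  cyclic : ∀ t ∈ I, IsCyclic Ω (R₀ t)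

/-- The algebra `R₀(O_t) = ⋂_{s ∈ I} α_{t,s} R(O_s)` of the observables which remain localized
under the dynamics. -/
def DeSitterTheory.localizedAlg (T : DeSitterTheory H) (α : ℝ) (L : ℝ → SO0) (I : Set ℝ)
    (O : ℝ → Set Mink) (t : ℝ) : StarSubalgebra ℂ (H →L[ℂ] H) :=
  ⨅ s ∈ I, (T.rwAlg α (O s)).map (T.propagator L t s).toStarAlgHom

end Quantum

end RWDyn

end

namespace RWDyn

open Real Filter Topology

/-! ### The Minkowski form and the action of the de Sitter group -/

/-! The dynamical part is formal: the propagators come from a representation, so their composition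
law, invariance of the global algebra and permutation of the algebras R₀(O_t) follow from the group
law. The content is cyclicity of `Ω`.

The attached curve carries the worldline: Λ_t x_0 = x_t (`IsObserverCurve.act_worldline`). It
therefore suffices to find one neighbourhood V of x_0 such that, for every t in `I`, Λ_t V lies in
each de Sitter wedge W with O_t ⊆ Ξ(W). Covariance then puts the de Sitter algebra of Λ_t V inside
R₀(O_t) (`dSAlg_le_localizedAlg`), and Reeh–Schlieder applies.

The geometric core is `mem_of_apices_mem_Xi`: if Ξ(W) contains both apices of the upright double
cone of size ε = π/2 - α around x, then x ∈ W. In conformal coordinates an edge is n·ω = 0, sin τ =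
b·ω, and Φ replaces b by (sin α) b = (cos ε) b. The horizons of the two wedges then differ by at
most ε in conformal time (`sin_lt_of_sin_add_lt`). Lying in an open double cone is an open condition
on the two apices, so compactness of `I` makes V uniform in t (`exists_open_transported_subset`). -/

theorem g_eq_dot (x y : Mink) : g x y = x 0 * y 0 - Fin.tail x ⬝ᵥ Fin.tail y := rfl

theorem tail_sub (x y : Mink) : Fin.tail (x - y) = Fin.tail x - Fin.tail y := rfl

theorem tail_smul (c : ℝ) (x : Mink) : Fin.tail (c • x) = c • Fin.tail x := rfl

theorem g_sub_left (x y z : Mink) : g (x - y) z = g x z - g y z := by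
  simp only [g_eq_dot, tail_sub, sub_dotProduct, Pi.sub_apply]; ring

theorem g_smul_left (c : ℝ) (x y : Mink) : g (c • x) y = c * g x y := by
  simp only [g_eq_dot, tail_smul, smul_dotProduct, Pi.smul_apply, smul_eq_mul]; ring

theorem g_sub_right (x y z : Mink) : g x (y - z) = g x y - g x z := by
  rw [g_comm, g_sub_left, g_comm y, g_comm z]

theorem g_smul_right (c : ℝ) (x y : Mink) : g x (c • y) = c * g x y := by
  rw [g_comm, g_smul_left, g_comm y]

theorem g_single_succ (i : Fin 4) (x : Mink) : g (Pi.single i.succ 1) x = -x i.succ := by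
  simp [g, Pi.single_apply, (Fin.succ_ne_zero _).symm]

theorem eq_of_g_eq {x y : Mink} (h : ∀ z, g z x = g z y) : x = y := by
  funext i
  refine Fin.cases ?_ (fun j => ?_) i
  · simpa only [g_e0_left] using h e0
  · simpa only [g_single_succ, neg_inj] using h (Pi.single j.succ 1)

theorem g_sub_self_of_mem_dS {x y : Mink} (hx : x ∈ dS) (hy : y ∈ dS) :
    g (x - y) (x - y) = -2 - 2 * g x y := by
  have hx : g x x = -1 := hx
  have hy : g y y = -1 := hy
  rw [g_sub_left, g_sub_right, g_sub_right, g_comm y x, hx, hy]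
  ring

theorem continuous_g : Continuous fun p : Mink × Mink => g p.1 p.2 := by
  unfold g; fun_prop

theorem _root_.HasDerivAt.g {u v : ℝ → Mink} {u' v' : Mink} {t : ℝ}
    (hu : HasDerivAt u u' t) (hv : HasDerivAt v v' t) :
    HasDerivAt (fun r => RWDyn.g (u r) (v r)) (RWDyn.g u' (v t) + RWDyn.g (u t) v') t := by
  rw [hasDerivAt_pi] at hu hv
  have h := ((hu 0).mul (hv 0)).sub
    (HasDerivAt.fun_sum (u := Finset.univ) fun i : Fin 4 => fun _ => (hu i.succ).mul (hv i.succ))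
  refine (h.congr_deriv ?_).congr_of_eventuallyEq (.of_forall fun r => ?_)
  · simp only [RWDyn.g, Finset.sum_add_distrib]; ring
  · simp [RWDyn.g]

theorem act_mul (L K : SO0) (x : Mink) : act (L * K) x = act L (act K x) := by
  simp [act, Matrix.mulVec_mulVec]

theorem act_one (x : Mink) : act 1 x = x := by simp [act]

theorem act_inv_act (L : SO0) (x : Mink) : act L⁻¹ (act L x) = x := by
  rw [← act_mul, inv_mul_cancel, act_one]

theorem act_act_inv (L : SO0) (x : Mink) : act L (act L⁻¹ x) = x := by
  rw [← act_mul, mul_inv_cancel, act_one]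

theorem g_act (L : SO0) (x y : Mink) : g (act L x) (act L y) = g x y := L.2.1 x y

theorem g_act_inv_right (L : SO0) (x y : Mink) : g x (act L⁻¹ y) = g (act L x) y := by
  rw [← g_act L, act_act_inv]

theorem act_mem_dS (L : SO0) {x : Mink} : act L x ∈ dS ↔ x ∈ dS := by
  simp only [dS, Set.mem_ofPred_eq, g_act]

theorem mem_act_image (L : SO0) (S : Set Mink) (x : Mink) : x ∈ act L '' S ↔ act L⁻¹ x ∈ S := by
  constructor
  · rintro ⟨y, hy, rfl⟩; rwa [act_inv_act]
  · exact fun h => ⟨_, h, act_act_inv L x⟩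

theorem act_image_mul (L K : SO0) (S : Set Mink) : act (L * K) '' S = act L '' (act K '' S) := by
  rw [Set.image_image]; simp only [act_mul]

theorem continuous_act (L : SO0) : Continuous (act L) := by
  unfold act; fun_prop

theorem act_image_mem_dSWedges (L : SO0) {W : Set Mink} (hW : W ∈ dSWedges) :
    act L '' W ∈ dSWedges := by
  obtain ⟨K, rfl⟩ := hW
  refine ⟨L * K, ?_⟩
  ext x
  rw [Set.mem_inter_iff, act_image_mul, mem_act_image, mem_act_image, Set.mem_inter_iff,
    act_mem_dS]

/-! ### Worldlines are transported by the attached curves -/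

section Worldline

variable {α : ℝ} {x : ℝ → Mink} (hx : IsWorldline α x)
include hx

theorem IsWorldline.hasDerivAt (t : ℝ) : HasDerivAt x (deriv x t) t :=
  (hx.contDiff.differentiable (by norm_num) t).hasDerivAt

theorem IsWorldline.g_deriv_self (t : ℝ) : g (deriv x t) (x t) = 0 := by
  have h := (hx.hasDerivAt t).g (hx.hasDerivAt t)
  have h1 : (fun r => g (x r) (x r)) = fun _ => -1 := funext fun r => (hx.mem r).1
  rw [h1, g_comm (x t)] at h
  have := h.unique (hasDerivAt_const t (-1 : ℝ))
  linarith

/-- This is where C² regularity enters: it makes the `deriv` in `acceleration` a genuine derivative.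
-/
theorem IsWorldline.differentiableAt_unitTangent (t : ℝ) :
    DifferentiableAt ℝ (unitTangent x) t := by
  have hd : HasDerivAt (deriv x) (deriv (deriv x) t) t := by
    have h2 : ContDiff ℝ (1 + 1) x := by simpa [one_add_one_eq_two] using hx.contDiff
    have h1 : ContDiff ℝ 1 (deriv x) := (contDiff_succ_iff_deriv.1 h2).2.2
    exact (h1.differentiable (by norm_num) t).hasDerivAt
  have hg := (hd.g hd).differentiableAt
  have hpos := hx.timelike t
  exact ((hg.sqrt hpos.ne').inv (Real.sqrt_pos.2 hpos).ne').smul hd.differentiableAt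

/-- Differentiating g(dx/ds, x) = 0 gives g(a, x) = -g(dx/ds, dx/ds), and the unit tangent has
square 1. -/
theorem IsWorldline.g_acceleration_self (t : ℝ) : g (acceleration x t) (x t) = -1 := by
  have h := (hx.differentiableAt_unitTangent t).hasDerivAt.g (hx.hasDerivAt t)
  have h1 : (fun r => g (unitTangent x r) (x r)) = fun _ => 0 := funext fun r => by
    rw [unitTangent, g_smul_left, hx.g_deriv_self, mul_zero]
  rw [h1] at h
  have h2 := h.unique (hasDerivAt_const t (0 : ℝ))
  have hpos := hx.timelike t
  have hs := Real.sqrt_pos.2 hpos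
  rw [unitTangent, g_smul_left] at h2
  rw [acceleration, g_smul_left, eq_neg_of_add_eq_zero_left h2]
  field_simp
  rw [Real.sq_sqrt hpos.le]

/-- For fixed y the function g(Λ_t y, x_t) is constant: since g(ẋ, x) = 0 and g(a, x) = -1, the
generator contributes -g(ẋ, Λ_t y), which cancels the term from differentiating x. Nondegeneracy of
g then identifies the two points, without appeal to uniqueness for the differential equation. -/
theorem IsObserverCurve.act_worldline {L : ℝ → SO0} (hL : IsObserverCurve x L) (t : ℝ) :
    act (L t) (x 0) = x t := by
  refine eq_of_g_eq fun z => ?_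
  obtain ⟨y, rfl⟩ : ∃ y, act (L t) y = z := ⟨_, act_act_inv (L t) z⟩
  rw [g_act]
  have hd : ∀ r, HasDerivAt (fun r => g (act (L r) y) (x r)) 0 r := fun r => by
    refine ((hL.hasDerivAt r y).g (hx.hasDerivAt r)).congr_deriv ?_
    rw [generator, g_sub_left, g_smul_left, g_smul_left, hx.g_deriv_self,
      hx.g_acceleration_self, g_comm (act (L r) y)]
    ring
  have := is_const_of_deriv_eq_zero (fun r => (hd r).differentiableAt) (fun r => (hd r).deriv) t 0
  simp only [hL.initial, act_one] at this
  exact this.symm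

end Worldline

theorem IsObserverCurve.continuous_entry {x : ℝ → Mink} {L : ℝ → SO0} (hL : IsObserverCurve x L)
    (i j : Fin 5) : Continuous fun t => (L t : GL (Fin 5) ℝ).val i j := by
  refine continuous_iff_continuousAt.2 fun t => ?_
  have h := (hasDerivAt_pi.1 (hL.hasDerivAt t (Pi.single j 1)) i).continuousAt
  simpa [act] using h

theorem IsObserverCurve.continuous_val {x : ℝ → Mink} {L : ℝ → SO0} (hL : IsObserverCurve x L) :
    Continuous fun t => (L t : GL (Fin 5) ℝ).val :=
  continuous_matrix fun i j => hL.continuous_entry i j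

theorem IsObserverCurve.continuous {x : ℝ → Mink} {L : ℝ → SO0} (hL : IsObserverCurve x L) :
    Continuous L := by
  refine Continuous.subtype_mk (f := fun t => (L t : GL (Fin 5) ℝ)) ?_ _
  refine Units.continuous_iff.2 ⟨hL.continuous_val, ?_⟩
  -- The topology on units also requires a continuous inverse. As the determinant is 1, the inverse
  -- is the adjugate, polynomial in the entries.
  have h : ∀ t, ((L t : GL (Fin 5) ℝ)⁻¹).val = (L t : GL (Fin 5) ℝ).val.adjugate := fun t => by
    rw [Matrix.coe_units_inv, Matrix.inv_def, (L t).2.2.1]; simp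
  simp only [h]
  exact hL.continuous_val.matrix_adjugate

theorem IsObserverCurve.continuous_act {x : ℝ → Mink} {L : ℝ → SO0} (hL : IsObserverCurve x L) :
    Continuous fun p : ℝ × Mink => act (L p.1) p.2 :=
  (hL.continuous_val.comp continuous_fst).matrix_mulVec continuous_snd

/-! ### A trigonometric inequality -/

/-- With b' = arcsin(β cos ε), one has cos b' ≥ β sin ε because β ≤ 1. Hence sin(b' + ε) ≥ β cos² ε
+ β sin² ε = β. -/
theorem arcsin_sub_arcsin_cos_mul_mem {ε β : ℝ} (hε : 0 ≤ ε) (hε' : ε ≤ π / 2) (hβ0 : 0 ≤ β)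
    (hβ1 : β ≤ 1) :
    0 ≤ arcsin β - arcsin (cos ε * β) ∧ arcsin β - arcsin (cos ε * β) ≤ ε := by
  have hk0 : 0 ≤ cos ε := cos_nonneg_of_neg_pi_div_two_le_of_le (by linarith) hε'
  have hk1 := cos_le_one ε
  have he0 : 0 ≤ sin ε := sin_nonneg_of_nonneg_of_le_pi hε (by linarith)
  have hkβ : cos ε * β ≤ β := by nlinarith
  have hkβ0 : 0 ≤ cos ε * β := by positivity
  refine ⟨sub_nonneg.2 (monotone_arcsin hkβ), ?_⟩
  -- Beyond π/2 the sine can no longer be inverted, but there the bound is trivial.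
  by_cases h : arcsin (cos ε * β) + ε ≤ π / 2
  · have h1 : β ≤ sin (arcsin (cos ε * β) + ε) := by
      rw [sin_add, sin_arcsin (by linarith) (by linarith), cos_arcsin]
      have h2 : sin ε * β ≤ √(1 - (cos ε * β) ^ 2) := by
        apply le_sqrt_of_sq_le
        have h3 : (sin ε * β) ^ 2 + (cos ε * β) ^ 2 = (sin ε ^ 2 + cos ε ^ 2) * β ^ 2 := by ring
        rw [sin_sq_add_cos_sq] at h3
        nlinarith
      nlinarith [sin_sq_add_cos_sq ε]
    have h3 := arcsin_nonneg.2 hkβ0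
    have := (arcsin_le_iff_le_sin ⟨by linarith, hβ1⟩ ⟨by linarith [pi_pos], h⟩).2 h1
    linarith
  · linarith [arcsin_le_pi_div_two β]

/-- With β = sin b, the bound β B + √(1 - β²) A is the inner product of (A, B) with the unit vector
(cos b, sin b). Passing from b' = arcsin(β cos ε) to b rotates that vector by at most ε. As (A, B)
lies in the unit disc, the arcsine of the inner product drops by at most the rotation angle, so
lowering τ + ε to τ compensates. -/
theorem sin_lt_of_sin_add_lt {ε β A B τ : ℝ} (hε : 0 ≤ ε) (hε' : ε ≤ π / 2) (hβ0 : 0 ≤ β)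
    (hβ1 : β ≤ 1) (hAB : A ^ 2 + B ^ 2 ≤ 1) (hτ : -(π / 2) ≤ τ) (hτε : τ + ε ≤ π / 2)
    (h : sin (τ + ε) < cos ε * β * B + √(1 - (cos ε * β) ^ 2) * A) :
    sin τ < β * B + √(1 - β ^ 2) * A := by
  obtain ⟨hδ0, hδε⟩ := arcsin_sub_arcsin_cos_mul_mem hε hε' hβ0 hβ1
  have hk0 : 0 ≤ cos ε := cos_nonneg_of_neg_pi_div_two_le_of_le (by linarith) hε'
  have hkβ0 : 0 ≤ cos ε * β := by positivity
  have hkβ1 : cos ε * β ≤ 1 := by nlinarith [cos_le_one ε]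
  set b := arcsin β
  set b' := arcsin (cos ε * β)
  have hsb : sin b = β := sin_arcsin (by linarith) hβ1
  have hcb : cos b = √(1 - β ^ 2) := cos_arcsin β
  have hsb' : sin b' = cos ε * β := sin_arcsin (by linarith) hkβ1
  have hcb' : cos b' = √(1 - (cos ε * β) ^ 2) := cos_arcsin _
  rw [← hcb', ← hsb'] at h
  rw [← hcb, ← hsb]
  set σ := sin b' * B + cos b' * A with hσ
  -- σ and ρ are the coordinates of (A, B) in a rotated orthonormal frame; the new bound is σ cos(b
  -- - b') - ρ sin(b - b').
  set ρ := sin b' * A - cos b' * B with hρ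
  have hσρ : σ ^ 2 + ρ ^ 2 ≤ 1 := by
    have : σ ^ 2 + ρ ^ 2 = (sin b' ^ 2 + cos b' ^ 2) * (A ^ 2 + B ^ 2) := by rw [hσ, hρ]; ring
    rwa [this, sin_sq_add_cos_sq, one_mul]
  have hσ1 : σ ≤ 1 := by nlinarith
  have hσ0 : -1 ≤ σ := by nlinarith
  have hlt : τ + ε < arcsin σ := by
    refine (lt_arcsin_iff_sin_lt ⟨by linarith, hτε⟩ ⟨hσ0, hσ1⟩).2 h
  have hρ' : ρ ≤ cos (arcsin σ) := by
    rw [cos_arcsin]; exact le_sqrt_of_sq_le (by linarith)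
  have hsd : 0 ≤ sin (b - b') :=
    sin_nonneg_of_nonneg_of_le_pi hδ0 (by linarith [pi_pos])
  have hle := arcsin_le_pi_div_two σ
  calc sin τ < sin (arcsin σ - (b - b')) :=
        sin_lt_sin_of_lt_of_le_pi_div_two hτ (by linarith) (by linarith)
    _ = σ * cos (b - b') - cos (arcsin σ) * sin (b - b') := by
        rw [sin_sub, sin_arcsin hσ0 hσ1]
    _ ≤ σ * cos (b - b') - ρ * sin (b - b') := by nlinarith
    _ = (sin b' ^ 2 + cos b' ^ 2) * (sin b * B + cos b * A) := by
        rw [cos_sub, sin_sub, hσ, hρ]; ring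
    _ = _ := by rw [sin_sq_add_cos_sq, one_mul]

/-- The upper apex controls the future horizon and the lower apex the past one; time reversal (τ, B)
↦ (-τ, -B) exchanges the two. -/
theorem abs_sin_sub_lt_of_apices {ε β A B τ : ℝ} (hε : 0 ≤ ε) (hε' : ε ≤ π / 2) (hβ0 : 0 ≤ β)
    (hβ1 : β ≤ 1) (hAB : A ^ 2 + B ^ 2 ≤ 1) (hl : -(π / 2) ≤ τ - ε) (hu : τ + ε ≤ π / 2)
    (h₁ : |sin (τ + ε) - cos ε * β * B| < √(1 - (cos ε * β) ^ 2) * A)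
    (h₂ : |sin (τ - ε) - cos ε * β * B| < √(1 - (cos ε * β) ^ 2) * A) :
    |sin τ - β * B| < √(1 - β ^ 2) * A := by
  rw [abs_lt] at h₁ h₂ ⊢
  have h3 := sin_lt_of_sin_add_lt hε hε' hβ0 hβ1 hAB (by linarith) hu (by linarith)
  have h4 := sin_lt_of_sin_add_lt (τ := -τ) (B := -B) hε hε' hβ0 hβ1 (by simpa using hAB)
    (by linarith) (by linarith) (by
      rw [show -τ + ε = -(τ - ε) by ring, sin_neg]; linarith)
  rw [sin_neg] at h4
  constructor <;> linarith

/-! ### Conformal time -/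

theorem neg_pi_div_two_lt_tau (x : Mink) : -(π / 2) < tau x := neg_pi_div_two_lt_arctan _

theorem tau_lt_pi_div_two (x : Mink) : tau x < π / 2 := arctan_lt_pi_div_two _

theorem cos_tau_pos (x : Mink) : 0 < cos (tau x) := cos_arctan_pos _

theorem tan_tau (x : Mink) : tan (tau x) = x 0 := tan_arctan _

theorem setTau_zero (x : Mink) (s : ℝ) : setTau x s 0 = tan s := rfl

theorem tail_setTau (x : Mink) (s : ℝ) :
    Fin.tail (setTau x s) = (cos (tau x) / cos s) • Fin.tail x := rfl

theorem mink_ext {x y : Mink} (h0 : x 0 = y 0) (h : Fin.tail x = Fin.tail y) : x = y := by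
  funext i
  exact Fin.cases h0 (fun j => congrFun h j) i

theorem tau_setTau (x : Mink) {s : ℝ} (h1 : -(π / 2) < s) (h2 : s < π / 2) :
    tau (setTau x s) = s := by
  rw [tau, setTau_zero, arctan_tan h1 h2]

theorem setTau_tau (x : Mink) : setTau x (tau x) = x := by
  refine mink_ext (tan_tau x) ?_
  rw [tail_setTau, div_self (cos_tau_pos x).ne', one_smul]

theorem setTau_setTau (x : Mink) {s : ℝ} (s' : ℝ) (h1 : -(π / 2) < s) (h2 : s < π / 2) :
    setTau (setTau x s) s' = setTau x s' := by
  refine mink_ext rfl ?_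
  have := (cos_pos_of_mem_Ioo ⟨h1, h2⟩).ne'
  rw [tail_setTau, tail_setTau, tail_setTau, tau_setTau x h1 h2, smul_smul]
  congr 1
  field_simp

/-- This says that ω = cos τ · x⃗ is a unit vector. -/
theorem cos_sq_tau_mul_tail {x : Mink} (hx : x ∈ dS) :
    cos (tau x) ^ 2 * (Fin.tail x ⬝ᵥ Fin.tail x) = 1 := by
  have h : g x x = -1 := hx
  rw [g_eq_dot] at h
  have h1 : Fin.tail x ⬝ᵥ Fin.tail x = 1 + tan (tau x) ^ 2 := by rw [tan_tau]; linarith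
  have h2 := (cos_tau_pos x).ne'
  rw [h1, tan_eq_sin_div_cos]
  field_simp
  exact cos_sq_add_sin_sq _

theorem g_setTau_setTau {x : Mink} (hx : x ∈ dS) {s s' : ℝ} (hs : cos s ≠ 0) (hs' : cos s' ≠ 0) :
    g (setTau x s) (setTau x s') = (sin s * sin s' - 1) / (cos s * cos s') := by
  have h := cos_sq_tau_mul_tail hx
  rw [g_eq_dot, setTau_zero, setTau_zero, tail_setTau, tail_setTau, smul_dotProduct,
    dotProduct_smul, tan_eq_sin_div_cos, tan_eq_sin_div_cos, smul_eq_mul, smul_eq_mul]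
  field_simp
  linarith

theorem setTau_mem_dS {x : Mink} (hx : x ∈ dS) {s : ℝ} (hs : cos s ≠ 0) : setTau x s ∈ dS := by
  change g _ _ = -1
  rw [g_setTau_setTau hx hs hs, div_eq_iff (by positivity)]
  linarith [sin_sq_add_cos_sq s]

theorem abs_lt_pi_div_two_of_abs_lt {α s : ℝ} (hα : α ≤ π / 2) (hs : |s| < α) :
    -(π / 2) < s ∧ s < π / 2 := by
  rw [abs_lt] at hs; constructor <;> linarith

theorem setTau_mem_RW {α : ℝ} (hα : α ≤ π / 2) {x : Mink} (hx : x ∈ dS) {s : ℝ} (hs : |s| < α) :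
    setTau x s ∈ RW α := by
  obtain ⟨h1, h2⟩ := abs_lt_pi_div_two_of_abs_lt hα hs
  exact ⟨setTau_mem_dS hx (cos_pos_of_mem_Ioo ⟨h1, h2⟩).ne', by rwa [tau_setTau x h1 h2]⟩

theorem g_setTau_sub_nonneg {x : Mink} (hx : x ∈ dS) {s s' : ℝ} (hs : 0 < cos s)
    (hs' : 0 < cos s') : 0 ≤ g (setTau x s - setTau x s') (setTau x s - setTau x s') := by
  rw [g_sub_self_of_mem_dS (setTau_mem_dS hx hs.ne') (setTau_mem_dS hx hs'.ne'),
    g_setTau_setTau hx hs.ne' hs'.ne']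
  have h : (sin s * sin s' - 1) / (cos s * cos s') ≤ -1 := by
    rw [div_le_iff₀ (mul_pos hs hs')]
    linarith [cos_le_one (s - s'), cos_sub s s']
  linarith

theorem continuousOn_setTau {S : Set Mink} {f : Mink → ℝ} (hf : Continuous f)
    (h : ∀ x ∈ S, cos (f x) ≠ 0) : ContinuousOn (fun x => setTau x (f x)) S := by
  have ht : Continuous tau := continuous_arctan.comp (continuous_apply 0)
  refine continuousOn_pi.2 fun i => ?_
  refine Fin.cases ?_ (fun j => ?_) i
  · exact fun x hx => ((continuousAt_tan.2 (h x hx)).comp hf.continuousAt).continuousWithinAt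
  · exact (((continuous_cos.comp ht).continuousOn.div (continuous_cos.comp hf).continuousOn h).mul
      (continuous_apply j.succ).continuousOn)

/-- The apices of the closed upright double cone around `x` belong to it. -/
theorem setTau_mem_closedUpright {α ε : ℝ} (hα : α ≤ π / 2) (hε : 0 ≤ ε) {x : Mink} (hx : x ∈ dS)
    (h1 : |tau x - ε| < α) (h2 : |tau x + ε| < α) :
    setTau x (tau x - ε) ∈ closedUpright α x ε ∧ setTau x (tau x + ε) ∈ closedUpright α x ε := by
  have c1 := abs_lt_pi_div_two_of_abs_lt hα h1
  have c2 := abs_lt_pi_div_two_of_abs_lt hα h2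
  have m1 := setTau_mem_RW hα hx h1
  have m2 := setTau_mem_RW hα hx h2
  have p1 := cos_pos_of_mem_Ioo c1
  have p2 := cos_pos_of_mem_Ioo c2
  have hle : tan (tau x - ε) ≤ tan (tau x + ε) :=
    strictMonoOn_tan.monotoneOn c1 c2 (by linarith)
  exact ⟨⟨⟨m1, g_setTau_sub_nonneg hx p1 p1, le_rfl⟩, ⟨m1, g_setTau_sub_nonneg hx p1 p2, hle⟩⟩,
    ⟨⟨m2, g_setTau_sub_nonneg hx p2 p1, hle⟩, ⟨m2, g_setTau_sub_nonneg hx p2 p2, le_rfl⟩⟩⟩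

/-! ### Wedges in conformal coordinates -/

/-- The wedge of all points on the side of `n` spacelike to the edge `flatEdge n b`. -/
def flatWedge (n b : Fin 4 → ℝ) : Set Mink :=
  {x | |x 0 - b ⬝ᵥ Fin.tail x| < √(1 - b ⬝ᵥ b) * (n ⬝ᵥ Fin.tail x)}

/-- The intersection of the hyperplanes `n · x⃗ = 0` and `x₀ = b · x⃗`. -/
def flatEdge (n b : Fin 4 → ℝ) : Set Mink :=
  {x | n ⬝ᵥ Fin.tail x = 0 ∧ x 0 = b ⬝ᵥ Fin.tail x}

/-- In the light-cone coordinates c ± a the map is multiplication by the positive factors p ± q. -/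
theorem abs_boost_lt_iff {p q a c : ℝ} (h1 : 0 < p + q) (h2 : 0 < p - q) :
    |p * a + q * c| < p * c + q * a ↔ |a| < c := by
  have e1 : p * c + q * a - (p * a + q * c) = (p - q) * (c - a) := by ring
  have e2 : p * c + q * a + (p * a + q * c) = (p + q) * (c + a) := by ring
  rw [abs_lt, abs_lt]
  constructor
  · rintro ⟨h3, h4⟩
    have := (pos_iff_pos_of_mul_pos (e2 ▸ by linarith : 0 < (p + q) * (c + a))).1 h1
    have := (pos_iff_pos_of_mul_pos (e1 ▸ by linarith : 0 < (p - q) * (c - a))).1 h2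
    constructor <;> linarith
  · rintro ⟨h3, h4⟩
    have := mul_pos h1 (by linarith : 0 < c + a)
    have := mul_pos h2 (by linarith : 0 < c - a)
    constructor <;> linarith

theorem dotProduct_sq_le (v w : Fin 4 → ℝ) : (v ⬝ᵥ w) ^ 2 ≤ (v ⬝ᵥ v) * (w ⬝ᵥ w) := by
  simpa only [dotProduct, ← pow_two] using Finset.sum_mul_sq_le_sq_mul_sq Finset.univ v w

theorem act_inv_zero (L : SO0) (x : Mink) : act L⁻¹ x 0 = g (act L e0) x := by
  rw [← g_act_inv_right, g_e0_left]

theorem act_inv_one (L : SO0) (x : Mink) : act L⁻¹ x 1 = -g (act L (Pi.single 1 1)) x := by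
  rw [← g_act_inv_right]
  have := g_single_succ 0 (act L⁻¹ x)
  simp only [Fin.succ_zero_eq_one] at this
  rw [this, neg_neg]

/-- The edge is orthogonal to u = L e₀ and v = L e₁. In the plane they span, a boost adapts the
basis to the time axis: p v - q u has no time component and yields n, while p u - q v has time
component p² - q² and yields (1, b) after rescaling. A boost does not change the wedge. -/
theorem exists_flatWedge_eq {W : Set Mink} (hW : W ∈ dSWedges) :
    ∃ n b : Fin 4 → ℝ, n ⬝ᵥ n = 1 ∧ n ⬝ᵥ b = 0 ∧ b ⬝ᵥ b < 1 ∧ W = flatWedge n b ∩ dS ∧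
      flatEdge n b ∩ dS ⊆ edge W := by
  obtain ⟨L, hL⟩ := hW
  set u := act L e0 with hu
  set v := act L (Pi.single 1 1) with hv
  set p := u 0 with hp
  set q := v 0 with hq
  have huu : Fin.tail u ⬝ᵥ Fin.tail u = p ^ 2 - 1 := by
    have : g u u = 1 := by rw [hu, g_act, g_e0_left]; simp [e0]
    rw [g_eq_dot] at this; linarith
  have hvv : Fin.tail v ⬝ᵥ Fin.tail v = q ^ 2 + 1 := by
    have : g v v = -1 := by
      rw [hv, g_act]
      have := g_single_succ 0 (Pi.single 1 1)
      simpa using this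
    rw [g_eq_dot] at this; linarith
  have huv : Fin.tail u ⬝ᵥ Fin.tail v = p * q := by
    have : g u v = 0 := by rw [hu, hv, g_act, g_e0_left]; simp
    rw [g_eq_dot] at this; linarith
  have hvu : Fin.tail v ⬝ᵥ Fin.tail u = p * q := by rw [dotProduct_comm, huv]
  have hp0 : 0 < p := by
    have : 0 < (L : GL (Fin 5) ℝ).val 0 0 := L.2.2.2
    simpa [hp, hu, act, e0] using this
  have hd : 1 ≤ p ^ 2 - q ^ 2 := by
    have := dotProduct_sq_le (Fin.tail u) (Fin.tail v)
    rw [huu, hvv, huv] at this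
    linarith
  have hpq1 : 0 < p + q := by nlinarith
  have hpq2 : 0 < p - q := by nlinarith
  set D := √(p ^ 2 - q ^ 2) with hD
  have hD2 : D ^ 2 = p ^ 2 - q ^ 2 := sq_sqrt (by linarith)
  have hD0 : 0 < D := sqrt_pos.2 (by linarith)
  set n := D⁻¹ • (p • Fin.tail v - q • Fin.tail u) with hn
  set b := (D ^ 2)⁻¹ • (p • Fin.tail u - q • Fin.tail v) with hb
  have hbb : b ⬝ᵥ b = 1 - (D⁻¹) ^ 2 := by
    simp only [hb, smul_dotProduct, dotProduct_smul, sub_dotProduct, dotProduct_sub, huu, hvv,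
      huv, hvu, smul_eq_mul]
    field_simp
    rw [hD2]; ring
  have hDsq : √(1 - b ⬝ᵥ b) = D⁻¹ := by
    rw [hbb, sub_sub_cancel, sqrt_sq (by positivity)]
  have hnx : ∀ x, n ⬝ᵥ Fin.tail x = D⁻¹ * (p * -g v x + q * g u x) := fun x => by
    simp only [hn, smul_dotProduct, sub_dotProduct, smul_eq_mul, g_eq_dot, ← hp, ← hq]
    ring
  have hbx : ∀ x, x 0 - b ⬝ᵥ Fin.tail x = (D ^ 2)⁻¹ * (p * g u x + q * -g v x) := fun x => by
    simp only [hb, smul_dotProduct, sub_dotProduct, smul_eq_mul, g_eq_dot, ← hp, ← hq]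
    field_simp
    rw [hD2]; ring
  refine ⟨n, b, ?_, ?_, ?_, ?_, ?_⟩
  · simp only [hn, smul_dotProduct, dotProduct_smul, sub_dotProduct, dotProduct_sub, huu, hvv,
      huv, hvu, smul_eq_mul]
    field_simp
    rw [hD2]; ring
  · simp only [hn, hb, smul_dotProduct, dotProduct_smul, sub_dotProduct, dotProduct_sub, huu, hvv,
      huv, hvu, smul_eq_mul]
    ring
  · rw [hbb]
    have : 0 < (D⁻¹) ^ 2 := by positivity
    linarith
  · rw [hL]
    ext x
    refine and_congr_left fun _ => ?_
    rw [mem_act_image]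
    simp only [stdWedge, flatWedge, Set.mem_ofPred_eq, act_inv_zero, act_inv_one]
    rw [hDsq, hbx, hnx, abs_mul, abs_of_pos (by positivity : 0 < (D ^ 2)⁻¹), ← mul_assoc,
      show D⁻¹ * D⁻¹ = (D ^ 2)⁻¹ by rw [pow_two, mul_inv], mul_lt_mul_iff_right₀ (by positivity),
      abs_boost_lt_iff hpq1 hpq2]
  · rintro x ⟨⟨h1, h2⟩, hx⟩
    refine ⟨L, hL, (mem_act_image L _ x).2 ?_, hx⟩
    rw [← sub_eq_zero, hbx] at h2
    rw [hnx] at h1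
    have h3 := (mul_eq_zero.1 h1).resolve_left (by positivity)
    have h4 := (mul_eq_zero.1 h2).resolve_left (by positivity)
    simp only [stdEdge, Set.mem_ofPred_eq, act_inv_zero, act_inv_one]
    have hd0 : p ^ 2 - q ^ 2 ≠ 0 := by linarith
    constructor
    · refine (mul_eq_zero.1 (?_ : (p ^ 2 - q ^ 2) * g u x = 0)).resolve_left hd0
      linear_combination p * h4 - q * h3
    · refine (mul_eq_zero.1 (?_ : (p ^ 2 - q ^ 2) * -g v x = 0)).resolve_left hd0
      linear_combination p * h3 - q * h4

theorem setTau_mem_flatWedge_iff (n b : Fin 4 → ℝ) (x : Mink) {s : ℝ} (hs : 0 < cos s) :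
    setTau x s ∈ flatWedge n b ↔
      |sin s - b ⬝ᵥ (cos (tau x) • Fin.tail x)| <
        √(1 - b ⬝ᵥ b) * (n ⬝ᵥ (cos (tau x) • Fin.tail x)) := by
  have h : Fin.tail (setTau x s) = (cos s)⁻¹ • (cos (tau x) • Fin.tail x) := by
    rw [tail_setTau, smul_smul]; congr 1; ring
  rw [flatWedge, Set.mem_ofPred_eq, h, setTau_zero, dotProduct_smul _ b, dotProduct_smul _ n,
    tan_eq_sin_div_cos, smul_eq_mul, smul_eq_mul, div_eq_inv_mul, ← mul_sub, abs_mul,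
    abs_of_pos (inv_pos.2 hs), mul_left_comm, mul_lt_mul_iff_right₀ (inv_pos.2 hs)]

/-- Bessel's inequality for two orthogonal vectors, the first of them normalized. -/
theorem bessel_of_orthogonal {n b w : Fin 4 → ℝ} (hn : n ⬝ᵥ n = 1) (hnb : n ⬝ᵥ b = 0)
    (hb : b ⬝ᵥ b = 1) : (n ⬝ᵥ w) ^ 2 + (b ⬝ᵥ w) ^ 2 ≤ w ⬝ᵥ w := by
  set r := w - (n ⬝ᵥ w) • n - (b ⬝ᵥ w) • b with hr
  have h : 0 ≤ r ⬝ᵥ r := Finset.sum_nonneg fun i _ => mul_self_nonneg _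
  have hbn : b ⬝ᵥ n = 0 := by rw [dotProduct_comm, hnb]
  have h2 : r ⬝ᵥ r = w ⬝ᵥ w - (n ⬝ᵥ w) ^ 2 - (b ⬝ᵥ w) ^ 2 := by
    simp only [hr, sub_dotProduct, dotProduct_sub, smul_dotProduct, dotProduct_smul, hn, hnb, hb,
      hbn, smul_eq_mul, dotProduct_comm w n, dotProduct_comm w b]
    ring
  linarith

theorem exists_abs_sq_add_sq_le_one {n b w : Fin 4 → ℝ} (hn : n ⬝ᵥ n = 1) (hnb : n ⬝ᵥ b = 0)
    (hw : w ⬝ᵥ w = 1) : ∃ B : ℝ, b ⬝ᵥ w = √(b ⬝ᵥ b) * B ∧ (n ⬝ᵥ w) ^ 2 + B ^ 2 ≤ 1 := by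
  rcases eq_or_ne b 0 with rfl | hb
  · refine ⟨0, by simp, ?_⟩
    have := dotProduct_sq_le n w
    rw [hn, hw] at this
    linarith
  · have hpos : 0 < b ⬝ᵥ b := by
      refine lt_of_le_of_ne (Finset.sum_nonneg fun i _ => mul_self_nonneg _) fun h => hb ?_
      exact dotProduct_self_eq_zero.1 h.symm
    have hs := sqrt_pos.2 hpos
    refine ⟨((√(b ⬝ᵥ b))⁻¹ • b) ⬝ᵥ w, ?_, ?_⟩
    · rw [smul_dotProduct, smul_eq_mul, mul_inv_cancel_left₀ hs.ne']
    · rw [← hw]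
      refine bessel_of_orthogonal hn (by rw [dotProduct_smul, hnb, smul_zero]) ?_
      rw [smul_dotProduct, dotProduct_smul, smul_eq_mul, smul_eq_mul]
      field_simp
      rw [sq_sqrt hpos.le]

/-- If the wedge with the slower edge contains the apices of the upright double cone of size `ε`
around `x`, then the wedge with the faster edge contains `x`. -/
theorem mem_flatWedge_of_apices {n b : Fin 4 → ℝ} (hn : n ⬝ᵥ n = 1) (hnb : n ⬝ᵥ b = 0)
    (hb : b ⬝ᵥ b < 1) {x : Mink} (hx : x ∈ dS) {ε : ℝ} (hε : 0 ≤ ε) (hε' : ε ≤ π / 2)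
    (hl : -(π / 2) < tau x - ε) (hu : tau x + ε < π / 2)
    (h1 : setTau x (tau x - ε) ∈ flatWedge n (cos ε • b))
    (h2 : setTau x (tau x + ε) ∈ flatWedge n (cos ε • b)) : x ∈ flatWedge n b := by
  rw [← setTau_tau x]
  rw [setTau_mem_flatWedge_iff _ _ _ (cos_pos_of_mem_Ioo ⟨by linarith, by linarith⟩)] at h1 h2
  rw [setTau_mem_flatWedge_iff _ _ _ (cos_tau_pos x)]
  set w := cos (tau x) • Fin.tail x with hw
  have hww : w ⬝ᵥ w = 1 := by
    rw [← cos_sq_tau_mul_tail hx, hw, smul_dotProduct, dotProduct_smul, smul_eq_mul, smul_eq_mul]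
    ring
  -- Only two components of ω matter: A along n and B along the direction of b. This reduces the
  -- claim to the planar inequality.
  obtain ⟨B, hB, hAB⟩ := exists_abs_sq_add_sq_le_one hn hnb hww
  have hbb : 0 ≤ b ⬝ᵥ b := Finset.sum_nonneg fun i _ => mul_self_nonneg _
  have e1 : 1 - (cos ε • b) ⬝ᵥ (cos ε • b) = 1 - (cos ε * √(b ⬝ᵥ b)) ^ 2 := by
    rw [mul_pow, sq_sqrt hbb, smul_dotProduct, dotProduct_smul, smul_eq_mul, smul_eq_mul]; ring
  have e2 : 1 - b ⬝ᵥ b = 1 - √(b ⬝ᵥ b) ^ 2 := by rw [sq_sqrt hbb]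
  rw [e1, smul_dotProduct, hB, smul_eq_mul, ← mul_assoc] at h1 h2
  rw [e2, hB]
  exact abs_sin_sub_lt_of_apices hε hε' (sqrt_nonneg _) (sqrt_le_one.2 hb.le)
    hAB hl.le hu.le h2 h1

/-! ### Robertson–Walker wedges -/

/-- Φ fixes ω and multiplies sin τ by sin α. The preimage of w has sin τ = b·ω, and |b·ω| < 1 by
Cauchy–Schwarz. -/
theorem flatEdge_smul_subset_image_Phi (α : ℝ) {n b : Fin 4 → ℝ} (hb : b ⬝ᵥ b < 1) :
    flatEdge n (sin α • b) ∩ dS ⊆ Phi α '' (flatEdge n b ∩ dS) := by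
  rintro w ⟨⟨h1, h2⟩, hw⟩
  have hlt : (cos (tau w) * (b ⬝ᵥ Fin.tail w)) ^ 2 < 1 := by
    have := mul_le_mul_of_nonneg_left (dotProduct_sq_le b (Fin.tail w)) (sq_nonneg (cos (tau w)))
    have e := cos_sq_tau_mul_tail hw
    rw [mul_left_comm, e] at this
    rw [mul_pow]
    linarith
  obtain ⟨hl1, hl2⟩ := (abs_lt.1 ((sq_lt_one_iff_abs_lt_one _).1 hlt))
  set s := arcsin (cos (tau w) * (b ⬝ᵥ Fin.tail w)) with hs
  have hsin : sin s = cos (tau w) * (b ⬝ᵥ Fin.tail w) := sin_arcsin hl1.le hl2.le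
  have hs1 : -(π / 2) < s := neg_pi_div_two_lt_arcsin.2 hl1
  have hs2 : s < π / 2 := arcsin_lt_pi_div_two.2 hl2
  have hcos : 0 < cos s := cos_pos_of_mem_Ioo ⟨hs1, hs2⟩
  refine ⟨setTau w s, ⟨⟨?_, ?_⟩, setTau_mem_dS hw hcos.ne'⟩, ?_⟩
  · rw [tail_setTau, dotProduct_smul, h1, smul_zero]
  · rw [setTau_zero, tail_setTau, dotProduct_smul, tan_eq_sin_div_cos, hsin, smul_eq_mul]
    ring
  · have h3 : sin α * sin s = sin (tau w) := by
      rw [smul_dotProduct, smul_eq_mul] at h2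
      rw [hsin, mul_left_comm, ← h2, ← tan_tau w, mul_comm, tan_mul_cos (cos_tau_pos w).ne']
    rw [Phi, tau_setTau w hs1 hs2, h3,
      arcsin_sin (neg_pi_div_two_lt_tau w).le (tau_lt_pi_div_two w).le,
      setTau_setTau w _ hs1 hs2, setTau_tau]

/-- The points of `dS` spacelike to an edge belong to one of the two wedges with this edge. -/
theorem sq_lt_of_spacelike_flatEdge {n b : Fin 4 → ℝ} (hn : n ⬝ᵥ n = 1) (hnb : n ⬝ᵥ b = 0)
    (hb : b ⬝ᵥ b < 1) {y : Mink} (hy : y ∈ dS)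
    (h : ∀ w ∈ flatEdge n b ∩ dS, g (y - w) (y - w) < 0) :
    (y 0 - b ⬝ᵥ Fin.tail y) ^ 2 < (1 - b ⬝ᵥ b) * (n ⬝ᵥ Fin.tail y) ^ 2 := by
  by_contra! hle
  set c := 1 - b ⬝ᵥ b with hc
  have hc0 : 0 < c := by linarith
  set P := y 0 - b ⬝ᵥ Fin.tail y with hP
  set Q := n ⬝ᵥ Fin.tail y with hQ
  have hyy : g y y = -1 := hy
  set u : Mink := Fin.cons 1 b with hu
  -- u and v are normal to the edge, and z below is the projection of y onto their orthogonal
  -- complement. If y were in neither wedge, then g(z, z) = -r² with r ≥ 1. So w = z/r is an edge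
  -- point with g(y - w, y - w) = 2r - 2 ≥ 0, which is not spacelike.
  set v : Mink := Fin.cons 0 n with hv
  have gu : ∀ x, g u x = x 0 - b ⬝ᵥ Fin.tail x := fun x => by simp [g_eq_dot, hu]
  have gv : ∀ x, g v x = -(n ⬝ᵥ Fin.tail x) := fun x => by simp [g_eq_dot, hv]
  have guu : g u u = c := by rw [gu]; simp [hu, hc]
  have gvv : g v v = -1 := by rw [gv]; simp [hv, hn]
  have guv : g u v = 0 := by simp [gu, hv, dotProduct_comm b n, hnb]
  have gvu : g v u = 0 := by rw [g_comm, guv]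
  have guy : g u y = P := gu y
  have gvy : g v y = -Q := gv y
  set z := y - (P / c) • u - Q • v with hz
  have guz : g u z = 0 := by
    rw [hz, g_sub_right, g_sub_right, g_smul_right, g_smul_right, guu, guv, guy]
    field_simp; ring
  have gvz : g v z = 0 := by
    rw [hz, g_sub_right, g_sub_right, g_smul_right, g_smul_right, gvu, gvv, gvy]; ring
  have gzz : g z z = g y z := by
    conv_lhs => rw [hz]
    rw [← hz, g_sub_left, g_sub_left, g_smul_left, g_smul_left, guz, gvz]; ring
  have gyz : g y z = -(1 + P ^ 2 / c - Q ^ 2) := by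
    rw [g_comm, hz, g_sub_left, g_sub_left, g_smul_left, g_smul_left, hyy, guy, gvy]; ring
  have hPQ : Q ^ 2 ≤ P ^ 2 / c := by rw [le_div_iff₀ hc0]; linarith
  set r := √(1 + P ^ 2 / c - Q ^ 2) with hr
  have hr2 : r ^ 2 = 1 + P ^ 2 / c - Q ^ 2 := sq_sqrt (by linarith)
  have hr1 : 1 ≤ r := one_le_sqrt.2 (by linarith)
  have hw : r⁻¹ • z ∈ dS := by
    change g _ _ = -1
    rw [g_smul_left, g_smul_right, gzz, gyz, ← hr2]
    field_simp
  have hwe : r⁻¹ • z ∈ flatEdge n b := by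
    constructor
    · rw [← neg_eq_zero, ← gv, g_smul_right, gvz, mul_zero]
    · rw [← sub_eq_zero, ← gu, g_smul_right, guz, mul_zero]
  have := h _ ⟨hwe, hw⟩
  rw [g_sub_self_of_mem_dS hy hw, g_smul_right, gyz, ← hr2, mul_neg, pow_two,
    inv_mul_cancel_left₀ (by positivity)] at this
  linarith

/-- A point spacelike to the transplanted edge satisfies the squared wedge inequality, which forces
n·x⃗ ≠ 0. The sign of n·x⃗ is thus constant on connected components, and it is positive on W. -/
theorem Xi_subset_flatWedge {α : ℝ} {W : Set Mink} {n b : Fin 4 → ℝ} (hn : n ⬝ᵥ n = 1)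
    (hnb : n ⬝ᵥ b = 0) (hb : b ⬝ᵥ b < 1) (hW : W = flatWedge n b ∩ dS)
    (hE : flatEdge n b ∩ dS ⊆ edge W) : Xi α W ⊆ flatWedge n (sin α • b) := by
  rintro y ⟨hy, z, hzc, hzW⟩
  set C := causalComplement α (Phi α '' edge W) with hC
  have hb0 : 0 ≤ b ⬝ᵥ b := Finset.sum_nonneg fun i _ => mul_self_nonneg _
  have hb' : (sin α • b) ⬝ᵥ (sin α • b) < 1 := by
    rw [smul_dotProduct, dotProduct_smul, smul_eq_mul, smul_eq_mul]
    nlinarith [sin_sq_le_one α]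
  have hnb' : n ⬝ᵥ (sin α • b) = 0 := by rw [dotProduct_smul, hnb, smul_zero]
  have key : ∀ x ∈ C, (x 0 - (sin α • b) ⬝ᵥ Fin.tail x) ^ 2 <
      (1 - (sin α • b) ⬝ᵥ (sin α • b)) * (n ⬝ᵥ Fin.tail x) ^ 2 := fun x hx =>
    sq_lt_of_spacelike_flatEdge hn hnb' hb' hx.1.1 fun w hw => hx.2 w
      (Set.image_mono hE (flatEdge_smul_subset_image_Phi α hb hw))
  have hne : ∀ x ∈ C, n ⬝ᵥ Fin.tail x ≠ 0 := fun x hx h0 => by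
    have := key x hx
    rw [h0] at this
    nlinarith [sq_nonneg (x 0 - (sin α • b) ⬝ᵥ Fin.tail x)]
  have hz : 0 < n ⬝ᵥ Fin.tail z := by
    rw [hW] at hzW
    have h2 : 0 < √(1 - b ⬝ᵥ b) * (n ⬝ᵥ Fin.tail z) := (abs_nonneg _).trans_lt hzW.1
    exact pos_of_mul_pos_right h2 (sqrt_nonneg _)
  have hpos : 0 < n ⬝ᵥ Fin.tail y := by
    by_contra! hle
    have hcont : Continuous fun x : Mink => n ⬝ᵥ Fin.tail x := by
      unfold Fin.tail dotProduct; fun_prop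
    obtain ⟨x, hx, hx0⟩ := isPreconnected_connectedComponentIn.intermediate_value
      (mem_connectedComponentIn hy) hzc hcont.continuousOn ⟨hle, hz.le⟩
    exact hne x (connectedComponentIn_subset _ _ hx) hx0
  refine abs_lt_of_sq_lt_sq ?_ (mul_nonneg (sqrt_nonneg _) hpos.le)
  rw [mul_pow, sq_sqrt (by linarith)]
  exact key y hy

/-- A region whose Robertson–Walker wedge contains the apices of the upright double cone of size
`π / 2 - α` around `x` has `x` in the corresponding de Sitter wedge. -/
theorem mem_of_apices_mem_Xi {α : ℝ} (hα0 : 0 ≤ α) (hα : α ≤ π / 2) {W : Set Mink}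
    (hW : W ∈ dSWedges) {x : Mink} (hx : x ∈ dS) (hl : |tau x - (π / 2 - α)| < α)
    (hu : |tau x + (π / 2 - α)| < α) (h1 : setTau x (tau x - (π / 2 - α)) ∈ Xi α W)
    (h2 : setTau x (tau x + (π / 2 - α)) ∈ Xi α W) : x ∈ W := by
  obtain ⟨n, b, hn, hnb, hb, hWe, hE⟩ := exists_flatWedge_eq hW
  have hsub := Xi_subset_flatWedge (α := α) hn hnb hb hWe hE
  -- sin α = cos(π/2 - α): this identity fixes the size π/2 - α of the double cone.
  rw [← cos_pi_div_two_sub] at hsub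
  rw [hWe]
  exact ⟨mem_flatWedge_of_apices hn hnb hb hx (by linarith) (by linarith)
    (abs_lt_pi_div_two_of_abs_lt hα hl).1 (abs_lt_pi_div_two_of_abs_lt hα hu).2
    (hsub h1) (hsub h2), hx⟩

/-! ### Neighbourhoods which stay inside a family of double cones -/

/-- The parameter space is kept general in order to vary the point and the time jointly. Membership
in `dS` is only a premise at nearby parameters, since it is not an open condition. -/
theorem eventually_setTau_mem_doubleCone {X : Type*} [TopologicalSpace X] {α c : ℝ}
    (hα : α ≤ π / 2) {Y p q : X → Mink} {z : X} (hY : ContinuousAt Y z) (hp : ContinuousAt p z)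
    (hq : ContinuousAt q z) (hc : |tau (Y z) + c| < α)
    (hm : setTau (Y z) (tau (Y z) + c) ∈ doubleCone α (p z) (q z)) :
    ∀ᶠ w in 𝓝 z, Y w ∈ dS → |tau (Y w) + c| < α ∧
      setTau (Y w) (tau (Y w) + c) ∈ doubleCone α (p w) (q w) := by
  have ht : Continuous fun x => tau x + c :=
    (continuous_arctan.comp (continuous_apply 0)).add continuous_const
  have hcos : cos (tau (Y z) + c) ≠ 0 :=
    (cos_pos_of_mem_Ioo (abs_lt_pi_div_two_of_abs_lt hα hc)).ne'
  have hA : ContinuousAt (fun w => setTau (Y w) (tau (Y w) + c)) z := by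
    have hopen : IsOpen {x : Mink | cos (tau x + c) ≠ 0} :=
      isOpen_ne_fun (continuous_cos.comp ht) continuous_const
    exact ((continuousOn_setTau ht fun x hx => hx).continuousAt (hopen.mem_nhds hcos)).comp
      (f := Y) hY
  have hev {u : X → Mink} (hu : ContinuousAt u z) : ContinuousAt (fun w => u w 0) z :=
    (continuous_apply 0).continuousAt.comp hu
  have hg {u : X → Mink} (hu : ContinuousAt u z) : ContinuousAt (fun w => g (u w) (u w)) z :=
    continuous_g.continuousAt.comp (hu.prodMk hu)
  obtain ⟨⟨-, hp1, hp2⟩, ⟨-, hq1, hq2⟩⟩ := hm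
  have h0 : ∀ᶠ w in 𝓝 z, |tau (Y w) + c| < α :=
    ((ht.continuousAt.comp hY).abs).eventually_lt continuousAt_const hc
  have h1 := continuousAt_const.eventually_lt (hg (hA.sub hp)) hp1
  have h2 := (hev hp).eventually_lt (hev hA) hp2
  have h3 := continuousAt_const.eventually_lt (hg (hA.sub hq)) hq1
  have h4 := (hev hA).eventually_lt (hev hq) hq2
  filter_upwards [h0, h1, h2, h3, h4] with w k0 k1 k2 k3 k4 hw
  have hRW := setTau_mem_RW hα hw k0
  exact ⟨k0, ⟨hRW, k1, k2⟩, ⟨hRW, k3, k4⟩⟩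

/-- Near the initial point of the worldline, all points are transported into every de Sitter wedge
whose Robertson–Walker wedge contains the region at the respective time. -/
theorem exists_open_transported_subset {α : ℝ} (hα0 : 0 < α) (hα : α ≤ π / 2) {x : ℝ → Mink}
    (hx : IsWorldline α x) {L : ℝ → SO0} (hL : IsObserverCurve x L) {I : Set ℝ}
    (hI : IsCompact I) {O : ℝ → Set Mink} (hO : IsContinuousDoubleConeFamily α I O)
    (hlarge : ∀ t ∈ I, SufficientlyLarge α (x t) (O t)) :
    ∃ V : Set Mink, IsOpen V ∧ Bornology.IsBounded V ∧ x 0 ∈ V ∧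
      ∀ t ∈ I, ∀ W ∈ dSWedges, O t ⊆ Xi α W → act (L t) '' (V ∩ dS) ⊆ W := by
  obtain ⟨p, q, hp, hq, hpq⟩ := hO
  have : CompactSpace I := isCompact_iff_compactSpace.1 hI
  have key : ∀ᶠ y in 𝓝 (x 0), ∀ t ∈ (Set.univ : Set I), act (L t) y ∈ dS →
      (|tau (act (L t) y) - (π / 2 - α)| < α ∧
        setTau (act (L t) y) (tau (act (L t) y) - (π / 2 - α)) ∈ O t) ∧
      (|tau (act (L t) y) + (π / 2 - α)| < α ∧
        setTau (act (L t) y) (tau (act (L t) y) + (π / 2 - α)) ∈ O t) := by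
    -- Compactness of `I` turns joint neighbourhoods of (x_0, t) into one neighbourhood of x_0 valid
    -- for all t.
    refine isCompact_univ.eventually_forall_of_forall_eventually fun t _ => ?_
    have hY : Continuous fun z : Mink × I => act (L z.2) z.1 :=
      hL.continuous_act.comp ((continuous_subtype_val.comp continuous_snd).prodMk continuous_fst)
    have hp' : Continuous fun z : Mink × I => p z.2 :=
      (continuousOn_iff_continuous_domRestrict.1 hp).comp continuous_snd
    have hq' : Continuous fun z : Mink × I => q z.2 :=
      (continuousOn_iff_continuous_domRestrict.1 hq).comp continuous_snd
    obtain ⟨hl, hu, hsub⟩ := hlarge t t.2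
    obtain ⟨hm1, hm2⟩ :=
      setTau_mem_closedUpright hα (by linarith : 0 ≤ π / 2 - α) (hx.mem t).1 hl hu
    -- The base point is x_0 even if 0 ∉ `I`, because transport along the worldline holds for all
    -- real times.
    have hz : act (L t) (x 0) = x t := hL.act_worldline hx t
    have hOt (t : I) : O t = doubleCone α (p t) (q t) := (hpq t t.2).2.2.1
    have e1 := eventually_setTau_mem_doubleCone (c := -(π / 2 - α)) (z := (x 0, t)) hα
      hY.continuousAt hp'.continuousAt hq'.continuousAt
      (by simpa only [hz, ← sub_eq_add_neg] using hl)
      (by simpa only [hz, ← hOt, ← sub_eq_add_neg] using hsub hm1)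
    have e2 := eventually_setTau_mem_doubleCone (c := π / 2 - α) (z := (x 0, t)) hα
      hY.continuousAt hp'.continuousAt hq'.continuousAt
      (by simpa only [hz] using hu) (by simpa only [hz, ← hOt] using hsub hm2)
    filter_upwards [e1, e2] with z k1 k2 hzd
    refine ⟨?_, ?_⟩
    · simpa only [hOt, ← sub_eq_add_neg] using k1 hzd
    · simpa only [hOt] using k2 hzd
  obtain ⟨V, hV, hVo, hxV⟩ := eventually_nhds_iff.1 key
  refine ⟨V ∩ Metric.ball (x 0) 1, hVo.inter Metric.isOpen_ball,
    Metric.isBounded_ball.subset Set.inter_subset_right, ⟨hxV, Metric.mem_ball_self one_pos⟩, ?_⟩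
  rintro t ht W hW hOW _ ⟨y, ⟨⟨hyV, -⟩, hy⟩, rfl⟩
  have hyd := (act_mem_dS (L t)).2 hy
  obtain ⟨⟨k1, k2⟩, k3, k4⟩ := hV y hyV ⟨t, ht⟩ trivial hyd
  exact mem_of_apices_mem_Xi hα0.le hα hW hyd k1 k3 (hOW k2) (hOW k4)

/-! ### Covariance of the algebras -/

section Quantum

variable {H : Type*} [NormedAddCommGroup H] [InnerProductSpace ℂ H] [CompleteSpace H]

theorem Ad_apply (u : unitary (H →L[ℂ] H)) (A : H →L[ℂ] H) :
    Ad u A = (u : H →L[ℂ] H) * A * star (u : H →L[ℂ] H) :=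
  Unitary.conjStarAlgAut_apply u A

theorem Ad_mul_apply (u v : unitary (H →L[ℂ] H)) (A : H →L[ℂ] H) :
    Ad (u * v) A = Ad u (Ad v A) :=
  Unitary.conjStarAlgAut_mul_apply u v A

theorem Ad_star (u : unitary (H →L[ℂ] H)) (A : H →L[ℂ] H) : Ad u (star A) = star (Ad u A) := by
  simp only [Ad_apply, star_mul, star_star, mul_assoc]

namespace DeSitterTheory

variable (T : DeSitterTheory H)

theorem Ad_U_mul_apply (L K : SO0) (A : H →L[ℂ] H) :
    Ad (T.U (L * K)) A = Ad (T.U L) (Ad (T.U K) A) := by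
  rw [map_mul, Ad_mul_apply]

theorem Ad_U_one_apply (A : H →L[ℂ] H) : Ad (T.U 1) A = A := by
  rw [map_one, Ad_apply]; simp

theorem Ad_U_inv_apply (L : SO0) (A : H →L[ℂ] H) : Ad (T.U L⁻¹) (Ad (T.U L) A) = A := by
  rw [← Ad_U_mul_apply, inv_mul_cancel, Ad_U_one_apply]

theorem Ad_U_apply_inv (L : SO0) (A : H →L[ℂ] H) : Ad (T.U L) (Ad (T.U L⁻¹) A) = A := by
  rw [← Ad_U_mul_apply, mul_inv_cancel, Ad_U_one_apply]

theorem mem_map_Ad_U (L : SO0) (M : StarSubalgebra ℂ (H →L[ℂ] H)) (A : H →L[ℂ] H) :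
    A ∈ M.map (Ad (T.U L)).toStarAlgHom ↔ Ad (T.U L⁻¹) A ∈ M := by
  rw [StarSubalgebra.mem_map]
  constructor
  · rintro ⟨B, hB, rfl⟩
    exact (T.Ad_U_inv_apply L B).symm ▸ hB
  · exact fun h => ⟨_, h, T.Ad_U_apply_inv L A⟩

theorem Ad_U_mem_alg (L : SO0) {W : Set Mink} (hW : W ∈ dSWedges) {A : H →L[ℂ] H}
    (hA : A ∈ (T.alg W).toStarSubalgebra) :
    Ad (T.U L) A ∈ (T.alg (act L '' W)).toStarSubalgebra := by
  rw [← T.covariant L W hW, mem_map_Ad_U, Ad_U_inv_apply]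
  exact hA

/-- Invariance of a set passes to its commutant; used twice, it gives invariance of the bicommutant
`globalAlg`. -/
theorem Ad_U_mem_centralizer {S : Set (H →L[ℂ] H)} (hS : ∀ L : SO0, ∀ B ∈ S, Ad (T.U L) B ∈ S)
    (L : SO0) {A : H →L[ℂ] H} (hA : A ∈ StarSubalgebra.centralizer ℂ S) :
    Ad (T.U L) A ∈ StarSubalgebra.centralizer ℂ S := by
  rw [StarSubalgebra.mem_centralizer_iff] at hA ⊢
  intro B hB
  obtain ⟨h1, h2⟩ := hA _ (hS L⁻¹ B hB)
  have h1' := congrArg (Ad (T.U L)) h1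
  have h2' := congrArg (Ad (T.U L)) h2
  rw [map_mul, map_mul, Ad_U_apply_inv] at h1'
  rw [map_mul, map_mul, Ad_star, Ad_U_apply_inv] at h2'
  exact ⟨h1', h2'⟩

theorem Ad_U_mem_globalAlg (L : SO0) {A : H →L[ℂ] H} (hA : A ∈ T.globalAlg) :
    Ad (T.U L) A ∈ T.globalAlg := by
  refine T.Ad_U_mem_centralizer (fun L B hB => T.Ad_U_mem_centralizer (fun L B hB => ?_) L hB) L hA
  simp only [Set.mem_iUnion] at hB ⊢
  obtain ⟨W, hW, hB⟩ := hB
  exact ⟨_, act_image_mem_dSWedges L hW, T.Ad_U_mem_alg L hW hB⟩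

theorem map_globalAlg (L : SO0) : T.globalAlg.map (Ad (T.U L)).toStarAlgHom = T.globalAlg := by
  ext A
  rw [mem_map_Ad_U]
  exact ⟨fun h => T.Ad_U_apply_inv L A ▸ T.Ad_U_mem_globalAlg L h, T.Ad_U_mem_globalAlg L⁻¹⟩

/-- Moving the unitaries onto the vectors reduces weak continuity of the propagators to strong
continuity of U. -/
theorem inner_Ad_U (L : SO0) (A : H →L[ℂ] H) (φ ψ : H) :
    ⟪φ, Ad (T.U L) A ψ⟫_ℂ =
      ⟪(T.U L⁻¹ : H →L[ℂ] H) φ, A ((T.U L⁻¹ : H →L[ℂ] H) ψ)⟫_ℂ := by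
  have h : ((T.U L⁻¹ : unitary (H →L[ℂ] H)) : H →L[ℂ] H) = star (T.U L : H →L[ℂ] H) := by
    rw [map_inv, ← Unitary.star_eq_inv, Unitary.coe_star]
  rw [h, Ad_apply, ContinuousLinearMap.star_eq_adjoint, ContinuousLinearMap.adjoint_inner_left]
  rfl

theorem continuous_inner_Ad_U (A : H →L[ℂ] H) (φ ψ : H) :
    Continuous fun L : SO0 => ⟪φ, Ad (T.U L) A ψ⟫_ℂ := by
  simp only [inner_Ad_U]
  exact ((T.continuous_U φ).comp continuous_inv).inner
    (A.continuous.comp ((T.continuous_U ψ).comp continuous_inv))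

theorem isPropagatorFamily {x : ℝ → Mink} {L : ℝ → SO0} (hL : IsObserverCurve x L) :
    IsPropagatorFamily T.globalAlg (T.propagator L) where
  map_eq t s := T.map_globalAlg _
  comp t s t' A _ := by
    rw [propagator, propagator, propagator, ← Ad_U_mul_apply, mul_assoc, inv_mul_cancel_left]
  refl t A _ := by rw [propagator, mul_inv_cancel, Ad_U_one_apply]
  continuous_left s A _ φ ψ :=
    (T.continuous_inner_Ad_U A φ ψ).comp (hL.continuous.mul continuous_const)
  continuous_right t A _ φ ψ :=
    (T.continuous_inner_Ad_U A φ ψ).comp (continuous_const.mul hL.continuous.inv)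

theorem mem_localizedAlg {α : ℝ} {L : ℝ → SO0} {I : Set ℝ} {O : ℝ → Set Mink} {t : ℝ}
    {A : H →L[ℂ] H} :
    A ∈ T.localizedAlg α L I O t ↔ ∀ s ∈ I, Ad (T.U (L s * (L t)⁻¹)) A ∈ T.rwAlg α (O s) := by
  simp only [localizedAlg, propagator, StarSubalgebra.mem_iInf, mem_map_Ad_U, mul_inv_rev, inv_inv]

theorem mem_rwAlg {α : ℝ} {O : Set Mink} {A : H →L[ℂ] H} :
    A ∈ T.rwAlg α O ↔ ∀ W ∈ dSWedges, O ⊆ Xi α W → A ∈ (T.alg W).toStarSubalgebra := by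
  simp only [rwAlg, StarSubalgebra.mem_iInf, Set.mem_ofPred_eq, and_imp]

theorem mem_dSAlg {O : Set Mink} {A : H →L[ℂ] H} :
    A ∈ T.dSAlg O ↔ ∀ W ∈ dSWedges, O ⊆ W → A ∈ (T.alg W).toStarSubalgebra := by
  simp only [dSAlg, StarSubalgebra.mem_iInf, Set.mem_ofPred_eq, and_imp]

theorem localizedAlg_le (α : ℝ) (L : ℝ → SO0) {I : Set ℝ} (O : ℝ → Set Mink) {t : ℝ}
    (ht : t ∈ I) : T.localizedAlg α L I O t ≤ T.rwAlg α (O t) := fun A hA => by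
  have := T.mem_localizedAlg.1 hA t ht
  rwa [mul_inv_cancel, Ad_U_one_apply] at this

theorem map_localizedAlg (α : ℝ) (L : ℝ → SO0) (I : Set ℝ) (O : ℝ → Set Mink) (t s : ℝ) :
    (T.localizedAlg α L I O s).map (T.propagator L t s).toStarAlgHom =
      T.localizedAlg α L I O t := by
  ext A
  rw [propagator, mem_map_Ad_U, mem_localizedAlg, mem_localizedAlg]
  simp only [← Ad_U_mul_apply, mul_inv_rev, inv_inv, mul_assoc, inv_mul_cancel_left]

/-- If Λ_s V ⊆ W, then Λ_t V ⊆ Λ_t Λ_s⁻¹ W, so an observable of Λ_t V belongs to the algebra of that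
wedge. Covariance under Λ_s Λ_t⁻¹ moves it into the algebra of W. -/
theorem dSAlg_le_localizedAlg {α : ℝ} {L : ℝ → SO0} {I : Set ℝ} {O : ℝ → Set Mink}
    {V : Set Mink}
    (hV : ∀ s ∈ I, ∀ W ∈ dSWedges, O s ⊆ Xi α W → act (L s) '' V ⊆ W) (t : ℝ) :
    T.dSAlg (act (L t) '' V) ≤ T.localizedAlg α L I O t := fun A hA => by
  refine T.mem_localizedAlg.2 fun s hs => T.mem_rwAlg.2 fun W hW hOW => ?_
  have hsub : act (L t) '' V ⊆ act (L t * (L s)⁻¹) '' W := by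
    have := Set.image_mono (f := act (L t * (L s)⁻¹)) (hV s hs W hW hOW)
    rwa [← act_image_mul, mul_assoc, inv_mul_cancel, mul_one] at this
  have h := T.Ad_U_mem_alg (L s * (L t)⁻¹) (act_image_mem_dSWedges _ hW)
    (T.mem_dSAlg.1 hA _ (act_image_mem_dSWedges _ hW) hsub)
  rwa [← act_image_mul, mul_assoc, inv_mul_cancel_left, mul_inv_cancel,
    show act 1 '' W = W by simp only [funext act_one, Set.image_id']] at h

end DeSitterTheory

theorem IsCyclic.mono {Ω : H} {M N : StarSubalgebra ℂ (H →L[ℂ] H)} (h : IsCyclic Ω M)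
    (hMN : M ≤ N) : IsCyclic Ω N := by
  refine Dense.mono ?_ h
  rintro _ ⟨A, hA, rfl⟩
  exact ⟨A, hMN hA, rfl⟩

end Quantum

theorem isOpen_act_image (L : SO0) {V : Set Mink} (hV : IsOpen V) : IsOpen (act L '' V) := by
  have : act L '' V = act L⁻¹ ⁻¹' V := Set.ext fun x => mem_act_image L V x
  rw [this]
  exact hV.preimage (continuous_act _)

theorem isBounded_act_image (L : SO0) {V : Set Mink} (hV : Bornology.IsBounded V) :
    Bornology.IsBounded (act L '' V) :=
  (hV.isCompact_closure.image (continuous_act L)).isBounded.subset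
    (Set.image_mono subset_closure)

theorem act_image_inter_dS (L : SO0) (V : Set Mink) :
    act L '' (V ∩ dS) = act L '' V ∩ dS := by
  ext x
  rw [Set.mem_inter_iff, mem_act_image, mem_act_image, Set.mem_inter_iff, act_mem_dS]

end RWDyn

theorem theorem4p3 {H : Type*} [NormedAddCommGroup H] [InnerProductSpace ℂ H] [CompleteSpace H]
    (T : RWDyn.DeSitterTheory H) (hRS : T.ReehSchlieder)
    (α : ℝ) (hα0 : 0 < α) (hα : α ≤ Real.pi / 2)
    (x : ℝ → RWDyn.Mink) (hx : RWDyn.IsWorldline α x)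
    (L : ℝ → RWDyn.SO0) (hL : RWDyn.IsObserverCurve x L)
    (I : Set ℝ) (hI : IsCompact I)
    (O : ℝ → Set RWDyn.Mink) (hO : RWDyn.IsContinuousDoubleConeFamily α I O)
    (hlarge : ∀ t ∈ I, RWDyn.SufficientlyLarge α (x t) (O t)) :
    RWDyn.IsQuasiCovariantDynamics T.globalAlg T.Ω (T.propagator L) I
      (fun t => T.rwAlg α (O t)) (T.localizedAlg α L I O) where
  propagatorFamily := T.isPropagatorFamily hL
  sub_le t ht := T.localizedAlg_le α L O ht
  map_eq t _ s _ := T.map_localizedAlg α L I O t s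
  cyclic t _ := by
    obtain ⟨V, hVo, hVb, hxV, hV⟩ :=
      RWDyn.exists_open_transported_subset hα0 hα hx hL hI hO hlarge
    have hle := T.dSAlg_le_localizedAlg hV t
    rw [RWDyn.act_image_inter_dS] at hle
    refine (hRS _ (RWDyn.isOpen_act_image (L t) hVo)
      ((RWDyn.isBounded_act_image (L t) hVb).subset Set.inter_subset_left) ?_).mono hle
    rw [← RWDyn.act_image_inter_dS]
    exact ⟨_, x 0, ⟨hxV, (hx.mem 0).1⟩, rfl⟩
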